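/- A Bell scenario $(n,m,v)$ consists of $n$ parties, $m_i$ measurement settings for each party $i$, and $v_{ij}$ outcomes for each setting $j$ of party $i$. Correlation vectors $p$ have the components $p_{k_1\ldots k_n|j_1\ldots j_n}$. For an assignment $\lambda$ of an outcome $\lambda_{ij}$ to every setting, the deterministic vector $p^\lambda$ has the components $p^\lambda_{k_1\ldots k_n|j_1\ldots j_n}=1$ if $\lambda_{ij_i}=k_i$ for all $i$, and $0$ otherwise. The Bell polytope $\mathcal B(n,m,v)$ is the convex hull of the vectors $p^\lambda$. An inequality $b\cdot p\ge b_0$ supports a facet of $\mathcal B$ if it holds on $\mathcal B$ and $F=\{p\in\mathcal B: b\cdot p=b_0\}$ satisfies $\emptyset\ne F\ne\mathcal B$ and $\dim F=\dim\mathcal B-1$. Two inequalities $b\cdot p\ge b_0$ and $c\cdot p\ge c_0$ are equivalent on $\mathcal B$ if there is $\mu>0$ with $c\cdot p-c_0=\mu\,(b\cdot p-b_0)$ for all $p\in\mathcal B$. Write $p(i,j,k)$ for the vector of those components of $p$ in which party $i$ uses setting $j$ and obtains outcome $k$. The inequality is genuinely $n$-partite if for no party $i$, setting $j$ and outcome $k$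 it is equivalent to an inequality of the form $c\cdot p(i,j,k)\ge 0$. Theorem 5. (1) Let $b\cdot p\ge b_0$ be a genuinely $n$-partite inequality that supports a facet of $\mathcal B(n,m,v)$. Let $\mathcal B^{m+1}$ be the polytope obtained by allowing one party one additional setting, with any number $\ge1$ of outcomes. Then $b\cdot p\ge b_0$, with coefficient $0$ on all components that use the new setting, supports a facet of $\mathcal B^{m+1}$. (2) Let $(n',m',v')$ contain the parties, settings and outcomes of $(n,m,v)$ (so $n'\ge n$, $m'\ge m$, $v'\ge v$), where every party of $(n',m',v')$ has at least one setting and every setting in either scenario has at least two outcomes. Given a map $r$ that merges each additional outcome of each original setting with an original outcome of that setting, and a choice $a$ of one setting and one outcome for every additional party, define the lifting of $c\cdot p\ge0$ to $(n',m',v')$ as follows. A component of $p'$ gets the coefficient $0$ unless all original parties use original settings and all additional parties use their chosen setting and obtain their chosen outcome; in that case it gets the coefficient that $c$ has at the original parties' settings and merged outcomes. Then, for every inequality $b\cdot p\ge b_0$ that supports a facet of $\mathcal B(n,m,v)$: (a) it is equivalent to an inequality of the form $c\cdot p\ge 0$; (b) if it is genuinely $n$-partite, then for every equivalent $c\cdot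 p\ge0$, every $r$ and every $a$, the lifting supports a facet of $\mathcal B(n',m',v')$; (c) in general there is a merging map $r$ such that for every equivalent $c\cdot p\ge0$ and every $a$, the lifting supports a facet of $\mathcal B(n',m',v')$. In particular, every facet of $\mathcal B(n,m,v)$ lifts to a facet of $\mathcal B(n',m',v')$. -/

import Mathlib

noncomputable section

open scoped Classical

/-- A Bell scenario `(n, m, v)`: a finite set of parties, for every party `i` a finite set of
`m_i` measurement settings, and for every setting `j` of `i` a finite set of `v_ij` outcomes.
Finite label sets are used instead of the intervals `{1, …, n}`, `{1, …, m_i}`, `{1, …, v_ij}`. -/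
structure Scenario where
  Party : Type
  Setting : Party → Type
  Outcome : (i : Party) → Setting i → Type
  fintypeParty : Fintype Party
  fintypeSetting : ∀ i, Fintype (Setting i)
  fintypeOutcome : ∀ i j, Fintype (Outcome i j)

namespace Scenario

attribute [instance] fintypeParty fintypeSetting fintypeOutcome

/-- A component of a correlation vector: a setting `j_i` and an outcome `k_i` for every party `i`.
There are `∏ i, ∑ j, v_ij` of them. -/
abbrev Index (S : Scenario) : Type := (i : S.Party) → (j : S.Setting i) × S.Outcome i j

/-- An assignment `λ` of an outcome to every setting of every party. -/
abbrev Assignment (S : Scenario) : Type := (i : S.Party) → (j : S.Setting i) → S.Outcome i j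

/-- The deterministic vector `p^λ`. -/
def det (S : Scenario) (l : S.Assignment) : S.Index → ℝ :=
  fun x => if ∀ i, l i (x i).1 = (x i).2 then 1 else 0

/-- The Bell polytope `𝓑(n, m, v)`. -/
def polytope (S : Scenario) : Set (S.Index → ℝ) := convexHull ℝ (Set.range S.det)

/-- The inequality `b · p ≥ b₀` is valid for the Bell polytope. -/
def Valid (S : Scenario) (b : S.Index → ℝ) (b₀ : ℝ) : Prop :=
  ∀ p ∈ S.polytope, b₀ ≤ dotProduct b p

/-- The face of the Bell polytope supported by the inequality `b · p ≥ b₀`. -/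
def face (S : Scenario) (b : S.Index → ℝ) (b₀ : ℝ) : Set (S.Index → ℝ) :=
  {p ∈ S.polytope | dotProduct b p = b₀}

/-- The dimension of (the affine hull of) a nonempty set of vectors. -/
def dim {ι : Type} (A : Set (ι → ℝ)) : ℕ := Module.finrank ℝ (affineSpan ℝ A).direction

/-- The inequality `b · p ≥ b₀` supports a facet of the Bell polytope: it is valid, and its face is
a proper face of dimension one less than that of the polytope. -/
structure SupportsFacet (S : Scenario) (b : S.Index → ℝ) (b₀ : ℝ) : Prop where
  valid : S.Valid b b₀
  nonempty : (S.face b b₀).Nonempty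
  proper : S.face b b₀ ≠ S.polytope
  dim_eq : dim (S.face b b₀) + 1 = dim S.polytope

/-- Two inequalities `b · p ≥ b₀` and `c · p ≥ c₀` are equivalent: up to a positive factor, they
differ by an equality that holds on the whole polytope. -/
def Equivalent (S : Scenario) (b : S.Index → ℝ) (b₀ : ℝ) (c : S.Index → ℝ) (c₀ : ℝ) : Prop :=
  ∃ μ : ℝ, 0 < μ ∧ ∀ p ∈ S.polytope, dotProduct c p - c₀ = μ * (dotProduct b p - b₀)

/-- The coefficient vector `c` involves only the components `p(i, j, k)`, those in which party `i`
uses setting `j` and obtains outcome `k`. -/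
def InvolvesOnly (S : Scenario) (c : S.Index → ℝ) (i : S.Party) (j : S.Setting i)
    (k : S.Outcome i j) : Prop :=
  ∀ x : S.Index, x i ≠ ⟨j, k⟩ → c x = 0

/-- `b · p ≥ b₀` is genuinely `n`-partite: it is not equivalent to an inequality of the form
`c · p(i, j, k) ≥ 0` for any party `i`, setting `j`, and outcome `k`. -/
def Genuine (S : Scenario) (b : S.Index → ℝ) (b₀ : ℝ) : Prop :=
  ∀ i j k, ¬ ∃ c : S.Index → ℝ, S.InvolvesOnly c i j k ∧ S.Equivalent b b₀ c 0

/-! One more measurement setting -/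

/-- The outcome sets after one more setting, with outcome set `W`, is allowed for party `i'`. -/
def addOutcome (S : Scenario) (i' : S.Party) (W : Type) (i : S.Party) :
    S.Setting i ⊕ PLift (i = i') → Type
  | .inl j => S.Outcome i j
  | .inr _ => W

/-- The scenario in which one more setting, with outcome set `W`, is allowed for party `i'`. -/
def addSetting (S : Scenario) (i' : S.Party) (W : Type) [Fintype W] : Scenario where
  Party := S.Party
  Setting i := S.Setting i ⊕ PLift (i = i')
  Outcome := S.addOutcome i' W
  fintypeParty := inferInstance
  fintypeSetting _ := inferInstance
  fintypeOutcome i j :=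
    match j with
    | .inl j => S.fintypeOutcome i j
    | .inr _ => ‹Fintype W›

/-- A component of the original correlation vectors, as a component in the scenario with one more
setting. -/
def oldIndex (S : Scenario) (i' : S.Party) (W : Type) [Fintype W] (x : S.Index) :
    (S.addSetting i' W).Index :=
  fun i => ⟨Sum.inl (x i).1, (x i).2⟩

/-- The coefficients `b`, read in the scenario with one more setting: the components that use the
new setting get the coefficient `0`. -/
def addSettingCoeff (S : Scenario) (i' : S.Party) (W : Type) [Fintype W] (b : S.Index → ℝ) :
    (S.addSetting i' W).Index → ℝ :=
  fun y => ∑ x : S.Index, if S.oldIndex i' W x = y then b x else 0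

/-! More parties, settings and outcomes -/

/-- `(n', m', v')` has at least the parties, settings and outcomes of `(n, m, v)`. -/
structure Extension (S T : Scenario) where
  party : S.Party ↪ T.Party
  setting : (i : S.Party) → S.Setting i ↪ T.Setting (party i)
  outcome : (i : S.Party) → (j : S.Setting i) →
    S.Outcome i j ↪ T.Outcome (party i) (setting i j)

namespace Extension

variable {S T : Scenario}

/-- For every original setting, a way to merge every additional outcome with an original one. -/
structure Merging (E : Extension S T) where
  merge : (i : S.Party) → (j : S.Setting i) →
    T.Outcome (E.party i) (E.setting i j) → S.Outcome i j
  merge_outcome : ∀ i j k, merge i j (E.outcome i j k) = k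

/-- A choice of one setting and one outcome of it for every additional party. -/
abbrev Choice (E : Extension S T) : Type :=
  (i : T.Party) → i ∉ Set.range E.party → (j : T.Setting i) × T.Outcome i j

/-- The component `y` of the larger scenario contributes to the component `x` of the original one:
the original parties use the settings of `x` and obtain outcomes that are merged to those of `x`,
and every additional party uses its chosen setting and obtains its chosen outcome. -/
def LiesOver (E : Extension S T) (r : E.Merging) (a : E.Choice) (x : S.Index) (y : T.Index) :
    Prop :=
  (∀ i, ∃ k, y (E.party i) = ⟨E.setting i (x i).1, k⟩ ∧ r.merge i (x i).1 k = (x i).2) ∧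
    ∀ i h, y i = a i h

/-- The coefficients of the lifted inequality. -/
def lift (E : Extension S T) (r : E.Merging) (a : E.Choice) (c : S.Index → ℝ) : T.Index → ℝ :=
  fun y => ∑ x : S.Index, if E.LiesOver r a x y then c x else 0

end Extension

end Scenario

end

/-! An inequality is studied through `f l = b ⬝ᵥ S.det l - b₀` on assignments. Once every party has
a setting, such functions are exactly `localFunctions`, since constants are local. The inequality
supports a facet iff `f` is nonnegative, has zeros, is not identically zero, and every local
function vanishing at its zeros is a multiple of it (`IsFacetFunction`).

Let `g` be local on the larger scenario and vanish wherever the lifted `f` does. Fix a matching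
assignment `m` and vary only the merged original outcomes: `g` becomes a local function that
vanishes at the zeros of `f`, hence is `t m * f`. It remains to see that `t` is constant, and for
this one outcome of `m` is changed at a time. A local function has no mixed second difference in two
disjoint sets of settings of one party (`rectangle_of_mem_localFunctions`). So if `t` changes with
the outcome of setting `j` of an original party `i`, then `f` depends on `i` at most through `j`;
being a facet function, it then lives on one outcome of `j` (`IsFacetFunction.isSupportedAt`), and
two outcomes have been merged to that one. Genuineness excludes such an `f`; otherwise a suitable
merging avoids that outcome. If `j` is additional, `f` would not depend on `i` at all. -/

noncomputable section

open scoped Classical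

namespace Scenario

/-! ### Local functions and coefficient vectors -/

/-- The functions on assignments spanned by those that only see one setting of every party. -/
def localFunctions (S : Scenario) : Submodule ℝ (S.Assignment → ℝ) :=
  Submodule.span ℝ {f | ∃ s : (i : S.Party) → S.Setting i,
    ∀ l m : S.Assignment, (∀ i, l i (s i) = m i (s i)) → f l = f m}

theorem dotProduct_det_mem_localFunctions (S : Scenario) (c : S.Index → ℝ) :
    (fun l => c ⬝ᵥ S.det l) ∈ S.localFunctions := by
  have h : (fun l => c ⬝ᵥ S.det l) = ∑ x, c x • fun l => S.det l x := by
    ext l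
    simp [dotProduct]
  rw [h]
  refine Submodule.sum_mem _ fun x _ => Submodule.smul_mem _ _ (Submodule.subset_span ?_)
  refine ⟨fun i => (x i).1, fun l m hlm => ?_⟩
  simp only [det, hlm]

theorem const_mem_localFunctions (S : Scenario) (s : (i : S.Party) → S.Setting i) (t : ℝ) :
    (fun _ => t) ∈ S.localFunctions :=
  Submodule.subset_span ⟨s, fun _ _ _ => rfl⟩

/-- A function that only sees the settings `s` is given by coefficients on components that use
the settings `s`. -/
theorem exists_coeff_of_selection (S : Scenario) (s : (i : S.Party) → S.Setting i)
    (f : S.Assignment → ℝ) (hf : ∀ l m : S.Assignment, (∀ i, l i (s i) = m i (s i)) → f l = f m) :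
    ∃ c : S.Index → ℝ, (∀ l, f l = c ⬝ᵥ S.det l) ∧
      ∀ x, c x ≠ 0 → ∃ l : S.Assignment, (x = fun i => ⟨s i, l i (s i)⟩) ∧ f l ≠ 0 := by
  refine ⟨fun x => if h : ∃ l : S.Assignment, x = fun i => ⟨s i, l i (s i)⟩ then f h.choose else 0,
    fun l => ?_, fun x hx => ?_⟩
  · rw [dotProduct, Finset.sum_eq_single (fun i => ⟨s i, l i (s i)⟩)]
    · have h : ∃ m : S.Assignment, (fun i => ⟨s i, l i (s i)⟩ : S.Index) =
          fun i => ⟨s i, m i (s i)⟩ := ⟨l, rfl⟩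
      rw [dif_pos h]
      have h1 : f l = f h.choose := hf _ _ fun i => by simpa using congrFun h.choose_spec i
      simp [det, ← h1]
    · intro x _ hx
      by_cases h : ∃ m : S.Assignment, x = fun i => ⟨s i, m i (s i)⟩
      · obtain ⟨m, rfl⟩ := h
        have : S.det l (fun i => ⟨s i, m i (s i)⟩) = 0 := by
          rw [det, if_neg]
          intro h
          exact hx (funext fun i => by simpa using (h i).symm)
        rw [this, mul_zero]
      · rw [dif_neg h, zero_mul]
    · simp
  · by_cases h : ∃ l : S.Assignment, x = fun i => ⟨s i, l i (s i)⟩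
    · simp only [dif_pos h] at hx
      exact ⟨_, h.choose_spec, hx⟩
    · simp [dif_neg h] at hx

theorem exists_coeff_of_mem_localFunctions (S : Scenario) {f : S.Assignment → ℝ}
    (hf : f ∈ S.localFunctions) : ∃ c : S.Index → ℝ, ∀ l, f l = c ⬝ᵥ S.det l := by
  induction hf using Submodule.span_induction with
  | mem f hf =>
    obtain ⟨s, hs⟩ := hf
    obtain ⟨c, hc, -⟩ := S.exists_coeff_of_selection s f hs
    exact ⟨c, hc⟩
  | zero => exact ⟨0, by simp⟩
  | add f g _ _ hf hg =>
    obtain ⟨c, hc⟩ := hf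
    obtain ⟨d, hd⟩ := hg
    exact ⟨c + d, fun l => by simp [hc, hd, add_dotProduct]⟩
  | smul t f _ hf =>
    obtain ⟨c, hc⟩ := hf
    exact ⟨t • c, fun l => by simp [hc, smul_dotProduct]⟩

/-- Fixing the assignment of party `i` and multiplying by the indicator of outcome `k` of setting
`j` yields coefficients that only involve the components `p(i, j, k)`. -/
theorem exists_involvesOnly (S : Scenario) {f : S.Assignment → ℝ} (hf : f ∈ S.localFunctions)
    (i : S.Party) (j : S.Setting i) (k : S.Outcome i j) (q : (j : S.Setting i) → S.Outcome i j) :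
    ∃ c : S.Index → ℝ, S.InvolvesOnly c i j k ∧
      ∀ l, c ⬝ᵥ S.det l = if l i j = k then f (Function.update l i q) else 0 := by
  induction hf using Submodule.span_induction with
  | mem f hf =>
    obtain ⟨s, hs⟩ := hf
    -- With the assignment of party `i` frozen at `q`, the value of `f` no longer depends on `l i`,
    -- so slot `i` of the selection is free to be `j`.
    obtain ⟨u, rfl, hu⟩ : ∃ u : (i : S.Party) → S.Setting i, u i = j ∧ ∀ i', i' ≠ i → u i' = s i' :=
      ⟨Function.update s i j, by simp, fun i' e => by simp [e]⟩
    obtain ⟨c, hc, hx⟩ := S.exists_coeff_of_selection u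
      (fun l => if l i (u i) = k then f (Function.update l i q) else 0) (by
        intro l m h
        simp only [h i]
        split_ifs
        · apply hs
          intro i'
          by_cases e : i' = i
          · subst e; simp
          · simpa [e] using hu i' e ▸ h i'
        · rfl)
    refine ⟨c, fun x hxi => ?_, fun l => (hc l).symm⟩
    by_contra h
    obtain ⟨l, rfl, hl⟩ := hx x h
    exact hl (if_neg fun e => hxi (by simp [e]))
  | zero => exact ⟨0, fun _ _ => rfl, by simp⟩
  | add f g _ _ hf hg =>
    obtain ⟨c, hc, hc'⟩ := hf
    obtain ⟨d, hd, hd'⟩ := hg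
    refine ⟨c + d, fun x hx => by simp [hc x hx, hd x hx], fun l => ?_⟩
    rw [add_dotProduct, hc', hd']
    split_ifs <;> simp
  | smul t f _ hf =>
    obtain ⟨c, hc, hc'⟩ := hf
    refine ⟨t • c, fun x hx => by simp [hc x hx], fun l => ?_⟩
    rw [smul_dotProduct, hc']
    split_ifs <;> simp

theorem dotProduct_det_eq_zero_of_involvesOnly (S : Scenario) {c : S.Index → ℝ} {i : S.Party}
    {j : S.Setting i} {k : S.Outcome i j} (hc : S.InvolvesOnly c i j k) {l : S.Assignment}
    (h : l i j ≠ k) : c ⬝ᵥ S.det l = 0 := by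
  refine Finset.sum_eq_zero fun x _ => ?_
  by_cases hx : x i = ⟨j, k⟩
  · rw [det, if_neg, mul_zero]
    intro h'
    have := h' i
    rw [hx] at this
    exact h this
  · rw [hc x hx, zero_mul]

/-- Locality survives substitution when the outcomes of `F l` at one setting per party are
determined by those of `l` at one setting per party. -/
theorem comp_mem_localFunctions {S T : Scenario} (F : S.Assignment → T.Assignment)
    (hF : ∀ s : (i : T.Party) → T.Setting i, ∃ u : (i : S.Party) → S.Setting i,
      ∀ l m : S.Assignment, (∀ i, l i (u i) = m i (u i)) → ∀ i, F l i (s i) = F m i (s i))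
    {g : T.Assignment → ℝ} (hg : g ∈ T.localFunctions) : (fun l => g (F l)) ∈ S.localFunctions := by
  induction hg using Submodule.span_induction with
  | mem f hf =>
    obtain ⟨s, hs⟩ := hf
    obtain ⟨u, hu⟩ := hF s
    exact Submodule.subset_span ⟨u, fun l m h => hs _ _ (hu l m h)⟩
  | zero => exact Submodule.zero_mem _
  | add f g _ _ hf hg => exact Submodule.add_mem _ hf hg
  | smul t f _ hf => exact Submodule.smul_mem _ t hf

/-- Local functions are sums of functions of one setting of party `i`, so that their mixed second
differences in two disjoint sets of settings of `i` vanish. -/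
theorem rectangle_of_mem_localFunctions (S : Scenario) {g : S.Assignment → ℝ}
    (hg : g ∈ S.localFunctions) {i : S.Party} {a b c d : S.Assignment}
    (hne : ∀ i', i' ≠ i → a i' = b i' ∧ a i' = c i' ∧ a i' = d i')
    (h : ∀ j, (a i j = b i j ∧ c i j = d i j) ∨ (a i j = c i j ∧ b i j = d i j)) :
    g a - g b = g c - g d := by
  induction hg using Submodule.span_induction with
  | mem f hf =>
    obtain ⟨s, hs⟩ := hf
    have key : ∀ x y : S.Assignment, (∀ i', i' ≠ i → x i' = y i') → x i (s i) = y i (s i) →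
        f x = f y := fun x y hxy hi => hs _ _ fun i' => by
      by_cases e : i' = i
      · subst e; exact hi
      · rw [hxy i' e]
    -- A generator sees a single setting of `i`: either both differences are zero, or the two sides
    -- agree term by term.
    rcases h (s i) with ⟨h1, h2⟩ | ⟨h1, h2⟩
    · rw [key a b (fun i' e => (hne i' e).1) h1,
        key c d (fun i' e => (hne i' e).2.1.symm.trans (hne i' e).2.2) h2]
      simp
    · rw [key a c (fun i' e => (hne i' e).2.1) h1,
        key b d (fun i' e => (hne i' e).1.symm.trans (hne i' e).2.2) h2]
  | zero => simp
  | add f g _ _ hf hg => simp only [Pi.add_apply]; linarith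
  | smul t f _ hf => simp only [Pi.smul_apply, smul_eq_mul, ← mul_sub, hf]

/-! Facets in terms of functions on assignments -/

/-- The property of `f = b · p - b₀`, as a function on assignments, that makes `b · p ≥ b₀` support
a facet. -/
structure IsFacetFunction (S : Scenario) (f : S.Assignment → ℝ) : Prop where
  nonneg : ∀ l, 0 ≤ f l
  exists_eq_zero : ∃ l, f l = 0
  exists_ne_zero : ∃ l, f l ≠ 0
  eq_mul : ∀ g ∈ S.localFunctions, (∀ l, f l = 0 → g l = 0) → ∃ t : ℝ, ∀ l, g l = t * f l

theorem det_mem_polytope (S : Scenario) (l : S.Assignment) : S.det l ∈ S.polytope :=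
  subset_convexHull ℝ _ ⟨l, rfl⟩

theorem le_of_mem_polytope (S : Scenario) {c : S.Index → ℝ} {c₀ : ℝ}
    (h : ∀ l, c₀ ≤ c ⬝ᵥ S.det l) {p : S.Index → ℝ} (hp : p ∈ S.polytope) : c₀ ≤ c ⬝ᵥ p := by
  have hconv : Convex ℝ {p : S.Index → ℝ | c₀ ≤ c ⬝ᵥ p} :=
    convex_halfSpace_ge ⟨dotProduct_add c, fun t x => dotProduct_smul t c x⟩ c₀
  refine convexHull_min ?_ hconv hp
  rintro _ ⟨l, rfl⟩
  exact h l

theorem eq_of_mem_polytope (S : Scenario) {c : S.Index → ℝ} {c₀ : ℝ}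
    (h : ∀ l, c ⬝ᵥ S.det l = c₀) {p : S.Index → ℝ} (hp : p ∈ S.polytope) : c ⬝ᵥ p = c₀ := by
  have h1 := S.le_of_mem_polytope (c := c) (c₀ := c₀) (fun l => (h l).ge) hp
  have h2 := S.le_of_mem_polytope (c := -c) (c₀ := -c₀) (fun l => by simp [h l]) hp
  rw [neg_dotProduct] at h2
  linarith

/-- An affine functional that is constant on the vertices of a face is constant on the face. -/
theorem eq_of_mem_face (S : Scenario) {b c : S.Index → ℝ} {b₀ c₀ : ℝ}
    (hb : ∀ l, b₀ ≤ b ⬝ᵥ S.det l) (h : ∀ l, b ⬝ᵥ S.det l = b₀ → c ⬝ᵥ S.det l = c₀)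
    {p : S.Index → ℝ} (hp : p ∈ S.face b b₀) : c ⬝ᵥ p = c₀ := by
  -- With such an `M`, both `M • b - c` and `M • b + c` give valid inequalities, which together
  -- force equality where `b` is tight. In the sum, terms at tight vertices are `0 / 0 = 0`.
  obtain ⟨M, hM⟩ : ∃ M : ℝ, ∀ l, |c ⬝ᵥ S.det l - c₀| ≤ M * (b ⬝ᵥ S.det l - b₀) := by
    refine ⟨∑ l, |c ⬝ᵥ S.det l - c₀| / (b ⬝ᵥ S.det l - b₀), fun l => ?_⟩
    by_cases hl : b ⬝ᵥ S.det l = b₀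
    · simp [hl, h l hl]
    · have hpos : 0 < b ⬝ᵥ S.det l - b₀ := sub_pos.2 (lt_of_le_of_ne (hb l) (Ne.symm hl))
      rw [← div_le_iff₀ hpos]
      exact Finset.single_le_sum (f := fun l => |c ⬝ᵥ S.det l - c₀| / (b ⬝ᵥ S.det l - b₀))
        (fun m _ => div_nonneg (abs_nonneg _) (sub_nonneg.2 (hb m))) (Finset.mem_univ l)
  have h1 := S.le_of_mem_polytope (c := M • b - c) (c₀ := M * b₀ - c₀) (fun l => by
    have := (abs_le.1 (hM l)).2
    rw [sub_dotProduct, smul_dotProduct, smul_eq_mul]; linarith) hp.1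
  have h2 := S.le_of_mem_polytope (c := M • b + c) (c₀ := M * b₀ + c₀) (fun l => by
    have := (abs_le.1 (hM l)).1
    rw [add_dotProduct, smul_dotProduct, smul_eq_mul]; linarith) hp.1
  rw [sub_dotProduct, smul_dotProduct, smul_eq_mul, hp.2] at h1
  rw [add_dotProduct, smul_dotProduct, smul_eq_mul, hp.2] at h2
  linarith

theorem dotProduct_eq_zero_of_mem_vectorSpan {ι : Type} [Fintype ι] {A : Set (ι → ℝ)}
    {c : ι → ℝ} {c₀ : ℝ} (h : ∀ p ∈ A, c ⬝ᵥ p = c₀) {v : ι → ℝ} (hv : v ∈ vectorSpan ℝ A) :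
    c ⬝ᵥ v = 0 := by
  have : vectorSpan ℝ A ≤ LinearMap.ker (dotProductBilin ℝ ℝ c) := by
    rw [vectorSpan_def, Submodule.span_le]
    rintro _ ⟨p, hp, q, hq, rfl⟩
    simp [h p hp, h q hq]
  simpa using this hv

theorem dim_eq_finrank_vectorSpan {ι : Type} (A : Set (ι → ℝ)) :
    dim A = Module.finrank ℝ (vectorSpan ℝ A) := by
  rw [dim, direction_affineSpan]

theorem mem_face_det_iff (S : Scenario) {b : S.Index → ℝ} {b₀ : ℝ} {l : S.Assignment} :
    S.det l ∈ S.face b b₀ ↔ b ⬝ᵥ S.det l = b₀ :=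
  ⟨fun h => h.2, fun h => ⟨S.det_mem_polytope l, h⟩⟩

theorem face_subset_polytope (S : Scenario) (b : S.Index → ℝ) (b₀ : ℝ) :
    S.face b b₀ ⊆ S.polytope := fun _ h => h.1

/-- A functional on `V` whose kernel contains a hyperplane `W` of `V` is a multiple of any other
such functional that is nonzero. -/
theorem exists_eq_mul_of_finrank_add_one {E : Type*} [AddCommGroup E] [Module ℝ E]
    [FiniteDimensional ℝ E] {V W : Submodule ℝ E} (hWV : W ≤ V)
    (hdim : Module.finrank ℝ W + 1 = Module.finrank ℝ V) (φ ψ : E →ₗ[ℝ] ℝ)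
    (hφ : ∀ w ∈ W, φ w = 0) (hψ : ∀ w ∈ W, ψ w = 0) {v : E} (hv : v ∈ V) (hφv : φ v ≠ 0) :
    ∀ w ∈ V, ψ w = ψ v / φ v * φ w := by
  have hker : W = V ⊓ LinearMap.ker φ := by
    -- As `φ v ≠ 0`, the kernel of `φ` in `V` is a proper subspace, so its dimension is at most that
    -- of `W`.
    refine Submodule.eq_of_le_of_finrank_le (le_inf hWV fun w hw => hφ w hw) ?_
    have hlt : V ⊓ LinearMap.ker φ < V :=
      lt_of_le_of_ne inf_le_left fun h => hφv (h.ge hv).2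
    have := Submodule.finrank_lt_finrank_of_lt hlt
    omega
  intro w hw
  have h : w - (φ w / φ v) • v ∈ W := by
    rw [hker]
    refine ⟨V.sub_mem hw (V.smul_mem _ hv), ?_⟩
    simp [hφv]
  have := hψ _ h
  rw [map_sub, map_smul, smul_eq_mul, sub_eq_zero] at this
  rw [this]
  ring

/-- If some party had no setting there would be no components, and a polytope of dimension 0 has no
facet in the sense of `dim_eq`. -/
theorem SupportsFacet.nonempty_selection {S : Scenario} {b : S.Index → ℝ} {b₀ : ℝ}
    (h : S.SupportsFacet b b₀) : Nonempty ((i : S.Party) → S.Setting i) := by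
  by_contra hne
  have : IsEmpty S.Index := ⟨fun x => hne ⟨fun i => (x i).1⟩⟩
  have h0 : dim S.polytope = 0 := by
    rw [dim]
    exact Module.finrank_zero_of_subsingleton
  have := h.dim_eq
  omega

theorem SupportsFacet.isFacetFunction {S : Scenario} {b : S.Index → ℝ} {b₀ : ℝ}
    (h : S.SupportsFacet b b₀) : S.IsFacetFunction fun l => b ⬝ᵥ S.det l - b₀ := by
  have hb : ∀ l, b₀ ≤ b ⬝ᵥ S.det l := fun l => h.valid _ (S.det_mem_polytope l)
  obtain ⟨l₀, hl₀⟩ : ∃ l, b ⬝ᵥ S.det l = b₀ := by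
    by_contra! hne
    obtain ⟨p, hp⟩ := h.nonempty
    -- If no vertex were tight, every affine identity would hold vacuously on the tight vertices,
    -- even `0 = 1`.
    have h1 := S.eq_of_mem_face (c := 0) (c₀ := 1) hb (fun l hl => absurd hl (hne l)) hp
    simp at h1
  obtain ⟨l₁, hl₁⟩ : ∃ l, b ⬝ᵥ S.det l ≠ b₀ := by
    by_contra! hall
    exact h.proper (Set.Subset.antisymm (S.face_subset_polytope b b₀)
      fun p hp => ⟨hp, S.eq_of_mem_polytope hall hp⟩)
  refine ⟨fun l => sub_nonneg.2 (hb l), ⟨l₀, by simp [hl₀]⟩, ⟨l₁, sub_ne_zero.2 hl₁⟩, ?_⟩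
  intro g hg hz
  obtain ⟨c, hc⟩ := S.exists_coeff_of_mem_localFunctions hg
  have hdim := h.dim_eq
  rw [dim_eq_finrank_vectorSpan, dim_eq_finrank_vectorSpan] at hdim
  have hV : ∀ l, S.det l - S.det l₀ ∈ vectorSpan ℝ S.polytope := fun l =>
    vsub_mem_vectorSpan ℝ (S.det_mem_polytope l) (S.det_mem_polytope l₀)
  have hcl : ∀ l, b ⬝ᵥ S.det l = b₀ → c ⬝ᵥ S.det l = 0 := fun l hl => by
    rw [← hc]; exact hz l (by simp [hl])
  have key := exists_eq_mul_of_finrank_add_one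
    (vectorSpan_mono ℝ (S.face_subset_polytope b b₀)) hdim
    (dotProductBilin ℝ ℝ b) (dotProductBilin ℝ ℝ c)
    (fun w hw => by simpa using dotProduct_eq_zero_of_mem_vectorSpan (fun p hp => hp.2) hw)
    (fun w hw => by
      simpa using dotProduct_eq_zero_of_mem_vectorSpan
        (fun p hp => S.eq_of_mem_face hb hcl hp) hw)
    (hV l₁) (by simpa [dotProduct_sub, hl₀] using sub_ne_zero.2 hl₁)
  refine ⟨c ⬝ᵥ (S.det l₁ - S.det l₀) / b ⬝ᵥ (S.det l₁ - S.det l₀), fun l => ?_⟩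
  have := key _ (hV l)
  simp only [dotProductBilin_apply_apply, dotProduct_sub, hl₀, hcl l₀ hl₀, sub_zero] at this ⊢
  rw [hc l, this]

theorem IsFacetFunction.supportsFacet {S : Scenario} (s : (i : S.Party) → S.Setting i)
    {b : S.Index → ℝ} {b₀ : ℝ} (h : S.IsFacetFunction fun l => b ⬝ᵥ S.det l - b₀) :
    S.SupportsFacet b b₀ := by
  have hb : ∀ l, b₀ ≤ b ⬝ᵥ S.det l := fun l => sub_nonneg.1 (h.nonneg l)
  obtain ⟨l₀, hl₀⟩ := h.exists_eq_zero
  obtain ⟨l₁, hl₁⟩ := h.exists_ne_zero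
  replace hl₀ : b ⬝ᵥ S.det l₀ = b₀ := sub_eq_zero.1 hl₀
  have hf₀ : S.det l₀ ∈ S.face b b₀ := S.mem_face_det_iff.2 hl₀
  refine ⟨fun p hp => S.le_of_mem_polytope hb hp, ⟨_, hf₀⟩, fun hF => ?_, ?_⟩
  · have := (hF ▸ S.det_mem_polytope l₁ : S.det l₁ ∈ S.face b b₀).2
    exact hl₁ (sub_eq_zero.2 this)
  · rw [dim_eq_finrank_vectorSpan, dim_eq_finrank_vectorSpan]
    set V := vectorSpan ℝ S.polytope
    set W := vectorSpan ℝ (S.face b b₀)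
    have hWV : W ≤ V := vectorSpan_mono ℝ (S.face_subset_polytope b b₀)
    have hv : S.det l₁ - S.det l₀ ∈ V :=
      vsub_mem_vectorSpan ℝ (S.det_mem_polytope l₁) (S.det_mem_polytope l₀)
    have hbv : b ⬝ᵥ (S.det l₁ - S.det l₀) ≠ 0 := by
      rw [dotProduct_sub, hl₀]; exact hl₁
    have hbW : ∀ w ∈ W, b ⬝ᵥ w = 0 := fun w hw =>
      dotProduct_eq_zero_of_mem_vectorSpan (fun p hp => hp.2) hw
    -- The facet directions and one transversal edge span everything: a functional killing both
    -- gives a local function that is a multiple of `f` and zero at `l₁`, hence zero, so it is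
    -- constant on the polytope.
    have hsup : W ⊔ Submodule.span ℝ {S.det l₁ - S.det l₀} = V := by
      refine le_antisymm (sup_le hWV ((Submodule.span_singleton_le_iff_mem _ _).2 hv)) ?_
      by_contra hle
      obtain ⟨w, hwV, hw⟩ := SetLike.not_le_iff_exists.1 hle
      obtain ⟨φ, hφw, hφ⟩ := Submodule.exists_dual_map_eq_bot_of_notMem hw inferInstance
      obtain ⟨c, rfl⟩ := (dotProductEquiv ℝ S.Index).surjective φ
      have hc : ∀ u ∈ W ⊔ Submodule.span ℝ {S.det l₁ - S.det l₀}, c ⬝ᵥ u = 0 := fun u hu => by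
        have := Submodule.mem_map_of_mem (f := dotProductEquiv ℝ S.Index c) hu
        rw [hφ] at this
        simpa using this
      obtain ⟨t, ht⟩ := h.eq_mul (fun l => c ⬝ᵥ S.det l - c ⬝ᵥ S.det l₀)
        (Submodule.sub_mem _ (S.dotProduct_det_mem_localFunctions c)
          (S.const_mem_localFunctions s _)) (fun l hl => by
          rw [← dotProduct_sub]
          exact hc _ (Submodule.mem_sup_left
            (vsub_mem_vectorSpan ℝ (S.mem_face_det_iff.2 (sub_eq_zero.1 hl)) hf₀)))
      have ht0 : t = 0 := by
        have h1 := ht l₁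
        rw [← dotProduct_sub, hc _ (Submodule.mem_sup_right (Submodule.mem_span_singleton_self _))]
          at h1
        exact (mul_eq_zero.1 h1.symm).resolve_right hl₁
      refine hφw ?_
      have := dotProduct_eq_zero_of_mem_vectorSpan (c := c) (c₀ := c ⬝ᵥ S.det l₀)
        (fun p hp => S.eq_of_mem_polytope (fun l => by
          have := ht l
          rw [ht0, zero_mul, sub_eq_zero] at this
          exact this) hp) hwV
      simpa using this
    have hne : S.det l₁ - S.det l₀ ≠ 0 := fun e => hbv (by simp [e])
    have hinf : W ⊓ Submodule.span ℝ {S.det l₁ - S.det l₀} = ⊥ := by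
      rw [Submodule.eq_bot_iff]
      rintro u ⟨hu, hu'⟩
      obtain ⟨t, rfl⟩ := Submodule.mem_span_singleton.1 hu'
      have := hbW _ hu
      rw [dotProduct_smul, smul_eq_mul] at this
      rw [(mul_eq_zero.1 this).resolve_right hbv, zero_smul]
    have := Submodule.finrank_sup_add_finrank_inf_eq W
      (Submodule.span ℝ {S.det l₁ - S.det l₀})
    rw [hsup, hinf, finrank_span_singleton hne, finrank_bot] at this
    omega

/-! ### Functions concentrated on one outcome -/

/-- The function `f` is given by an inequality of the form `c · p(i, j, k) ≥ 0`. -/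
def IsSupportedAt (S : Scenario) (f : S.Assignment → ℝ) (i : S.Party) (j : S.Setting i)
    (k : S.Outcome i j) : Prop :=
  ∃ c : S.Index → ℝ, S.InvolvesOnly c i j k ∧ ∀ l, f l = c ⬝ᵥ S.det l

theorem IsSupportedAt.const_mul {S : Scenario} {f : S.Assignment → ℝ} {i : S.Party}
    {j : S.Setting i} {k : S.Outcome i j} (h : S.IsSupportedAt f i j k) (t : ℝ) :
    S.IsSupportedAt (fun l => t * f l) i j k := by
  obtain ⟨c, hc, hf⟩ := h
  exact ⟨t • c, fun x hx => by simp [hc x hx], fun l => by simp [hf, smul_dotProduct]⟩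

theorem IsSupportedAt.apply_eq_zero {S : Scenario} {f : S.Assignment → ℝ} {i : S.Party}
    {j : S.Setting i} {k : S.Outcome i j} (h : S.IsSupportedAt f i j k) {l : S.Assignment}
    (hl : l i j ≠ k) : f l = 0 := by
  obtain ⟨c, hc, hf⟩ := h
  rw [hf, S.dotProduct_det_eq_zero_of_involvesOnly hc hl]

theorem Genuine.not_isSupportedAt {S : Scenario} {b c : S.Index → ℝ} {b₀ c₀ : ℝ}
    (h : S.Genuine b b₀) (hc : S.Equivalent b b₀ c c₀) (i : S.Party) (j : S.Setting i)
    (k : S.Outcome i j) : ¬ S.IsSupportedAt (fun l => c ⬝ᵥ S.det l - c₀) i j k := by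
  rintro ⟨d, hd, hf⟩
  obtain ⟨μ, hμ, he⟩ := hc
  refine h i j k ⟨d, hd, μ, hμ, fun p hp => ?_⟩
  rw [← he p hp]
  have := S.eq_of_mem_polytope (c := d - c) (c₀ := -c₀)
    (fun l => by rw [sub_dotProduct, ← hf l]; ring) hp
  rw [sub_dotProduct] at this
  linarith

theorem Equivalent.refl (S : Scenario) (b : S.Index → ℝ) (b₀ : ℝ) : S.Equivalent b b₀ b b₀ :=
  ⟨1, one_pos, fun p _ => by ring⟩

theorem IsFacetFunction.const_mul {S : Scenario} {f : S.Assignment → ℝ} (h : S.IsFacetFunction f)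
    {μ : ℝ} (hμ : 0 < μ) : S.IsFacetFunction fun l => μ * f l := by
  obtain ⟨l₀, hl₀⟩ := h.exists_eq_zero
  obtain ⟨l₁, hl₁⟩ := h.exists_ne_zero
  refine ⟨fun l => mul_nonneg hμ.le (h.nonneg l), ⟨l₀, by simp [hl₀]⟩,
    ⟨l₁, mul_ne_zero hμ.ne' hl₁⟩, fun g hg hz => ?_⟩
  obtain ⟨t, ht⟩ := h.eq_mul g hg fun l hl => hz l (by simp [hl])
  exact ⟨t / μ, fun l => by rw [ht]; field_simp⟩

/-- A facet function that sees only one setting of party `i` sees only one outcome of it. -/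
theorem IsFacetFunction.isSupportedAt {S : Scenario} {f : S.Assignment → ℝ}
    (h : S.IsFacetFunction f) (hf : f ∈ S.localFunctions) (i : S.Party) (j : S.Setting i)
    (hij : ∀ l m : S.Assignment, (∀ i', i' ≠ i → l i' = m i') → l i j = m i j → f l = f m)
    {l₁ : S.Assignment} (hl₁ : f l₁ ≠ 0) :
    S.IsSupportedAt f i j (l₁ i j) := by
  obtain ⟨c, hc, hcl⟩ := S.exists_involvesOnly hf i j (l₁ i j) (l₁ i)
  have hcl' : ∀ l, c ⬝ᵥ S.det l = if l i j = l₁ i j then f l else 0 := fun l => by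
    rw [hcl]
    split_ifs with e
    · exact hij _ _ (fun i' hi' => by simp [hi']) (by simp [e])
    · rfl
  -- Restricting `f` to the outcome `l₁ i j` keeps it local and keeps its zeros, so the restriction
  -- is a multiple of `f`; they agree at `l₁`, so the factor is 1.
  obtain ⟨t, ht⟩ := h.eq_mul _ (S.dotProduct_det_mem_localFunctions c) fun l hl => by
    simp [hcl', hl]
  have ht1 : t = 1 := by
    have := ht l₁
    simp only [hcl', if_true] at this
    exact mul_right_cancel₀ hl₁ (by rw [← this, one_mul])
  exact ⟨c, hc, fun l => by rw [ht, ht1, one_mul]⟩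

end Scenario

/-! ### Moving assignments along an extension -/

/-- The dependent function that is `f` on the range of the embedding `e`, and `g` off it. -/
def extendPi {A B : Type*} {β : B → Type*} (e : A ↪ B) (f : ∀ a, β (e a))
    (g : ∀ b, b ∉ Set.range e → β b) (b : B) : β b :=
  if h : b ∈ Set.range e then h.choose_spec ▸ f h.choose else g b h

@[simp]
theorem extendPi_apply {A B : Type*} {β : B → Type*} (e : A ↪ B) (f : ∀ a, β (e a))
    (g : ∀ b, b ∉ Set.range e → β b) (a : A) : extendPi e f g (e a) = f a := by
  have key : ∀ a' (h : e a' = e a), h ▸ f a' = f a := fun a' h => by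
    obtain rfl := e.injective h
    rfl
  rw [extendPi, dif_pos ⟨a, rfl⟩]
  exact key _ _

theorem extendPi_of_notMem {A B : Type*} {β : B → Type*} (e : A ↪ B) (f : ∀ a, β (e a))
    (g : ∀ b, b ∉ Set.range e → β b) {b : B} (h : b ∉ Set.range e) : extendPi e f g b = g b h :=
  dif_neg h

namespace Scenario

namespace Extension

variable {S T : Scenario}

/-- The assignment of merged outcomes to the original settings. -/
def restrict (E : Extension S T) (r : E.Merging) (m : T.Assignment) : S.Assignment :=
  fun i j => r.merge i j (m (E.party i) (E.setting i j))

/-- Every additional party obtains its chosen outcome. -/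
def Matches (E : Extension S T) (a : E.Choice) (m : T.Assignment) : Prop :=
  ∀ i h, m i (a i h).1 = (a i h).2

/-- The lifting of a function on assignments. -/
def liftFunction (E : Extension S T) (r : E.Merging) (a : E.Choice) (f : S.Assignment → ℝ)
    (m : T.Assignment) : ℝ :=
  if E.Matches a m then f (E.restrict r m) else 0

/-- Change the outcomes that `m` assigns to the original settings, where necessary, so that they
merge to those of `l`. -/
def overwrite (E : Extension S T) (r : E.Merging) (m : T.Assignment) (l : S.Assignment) :
    T.Assignment :=
  extendPi E.party
    (fun i => extendPi (E.setting i)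
      (fun j => if r.merge i j (m (E.party i) (E.setting i j)) = l i j
        then m (E.party i) (E.setting i j) else E.outcome i j (l i j))
      (fun j _ => m (E.party i) j))
    (fun i _ => m i)

theorem overwrite_old (E : Extension S T) (r : E.Merging) (m : T.Assignment) (l : S.Assignment)
    (i : S.Party) (j : S.Setting i) : E.overwrite r m l (E.party i) (E.setting i j) =
      if r.merge i j (m (E.party i) (E.setting i j)) = l i j
        then m (E.party i) (E.setting i j) else E.outcome i j (l i j) := by
  simp [overwrite]

theorem overwrite_newSetting (E : Extension S T) (r : E.Merging) (m : T.Assignment)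
    (l : S.Assignment) (i : S.Party) {j : T.Setting (E.party i)}
    (h : j ∉ Set.range (E.setting i)) : E.overwrite r m l (E.party i) j = m (E.party i) j := by
  simp [overwrite, extendPi_of_notMem _ _ _ h]

theorem overwrite_newParty (E : Extension S T) (r : E.Merging) (m : T.Assignment)
    (l : S.Assignment) {i : T.Party} (h : i ∉ Set.range E.party) :
    E.overwrite r m l i = m i := by
  simp [overwrite, extendPi_of_notMem _ _ _ h]

theorem merge_overwrite (E : Extension S T) (r : E.Merging) (m : T.Assignment) (l : S.Assignment)
    (i : S.Party) (j : S.Setting i) :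
    r.merge i j (E.overwrite r m l (E.party i) (E.setting i j)) = l i j := by
  rw [overwrite_old]
  split_ifs with h
  · exact h
  · exact r.merge_outcome i j _

theorem restrict_overwrite (E : Extension S T) (r : E.Merging) (m : T.Assignment)
    (l : S.Assignment) : E.restrict r (E.overwrite r m l) = l := by
  funext i j
  exact E.merge_overwrite r m l i j

theorem overwrite_congr (E : Extension S T) (r : E.Merging) {m m' : T.Assignment}
    {l l' : S.Assignment} {i : T.Party} (hm : m i = m' i)
    (hl : ∀ i', E.party i' = i → l i' = l' i') : E.overwrite r m l i = E.overwrite r m' l' i := by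
  by_cases hi : i ∈ Set.range E.party
  · obtain ⟨i, rfl⟩ := hi
    funext j
    by_cases hj : j ∈ Set.range (E.setting i)
    · obtain ⟨j, rfl⟩ := hj
      rw [overwrite_old, overwrite_old, hm, hl i rfl]
    · rw [overwrite_newSetting _ _ _ _ _ hj, overwrite_newSetting _ _ _ _ _ hj, hm]
  · rw [overwrite_newParty _ _ _ _ hi, overwrite_newParty _ _ _ _ hi, hm]

/-- This is why `overwrite` keeps outcomes that already merge correctly: every assignment lies in
its own slice. -/
theorem overwrite_restrict (E : Extension S T) (r : E.Merging) (m : T.Assignment) :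
    E.overwrite r m (E.restrict r m) = m := by
  funext i
  by_cases hi : i ∈ Set.range E.party
  · obtain ⟨i, rfl⟩ := hi
    funext j
    by_cases hj : j ∈ Set.range (E.setting i)
    · obtain ⟨j, rfl⟩ := hj
      rw [overwrite_old]
      exact if_pos rfl
    · rw [overwrite_newSetting _ _ _ _ _ hj]
  · rw [overwrite_newParty _ _ _ _ hi]

theorem matches_overwrite_iff (E : Extension S T) (r : E.Merging) (a : E.Choice)
    (m : T.Assignment) (l : S.Assignment) :
    E.Matches a (E.overwrite r m l) ↔ E.Matches a m := by
  simp only [Matches]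
  refine forall_congr' fun i => forall_congr' fun h => ?_
  rw [overwrite_newParty _ _ _ _ h]

theorem liftFunction_overwrite (E : Extension S T) (r : E.Merging) (a : E.Choice)
    (f : S.Assignment → ℝ) {m : T.Assignment} (hm : E.Matches a m) (l : S.Assignment) :
    E.liftFunction r a f (E.overwrite r m l) = f l := by
  rw [liftFunction, if_pos ((E.matches_overwrite_iff r a m l).2 hm), restrict_overwrite]

theorem comp_overwrite_mem_localFunctions (E : Extension S T) (r : E.Merging) (m : T.Assignment)
    (s₀ : (i : S.Party) → S.Setting i) {g : T.Assignment → ℝ} (hg : g ∈ T.localFunctions) :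
    (fun l => g (E.overwrite r m l)) ∈ S.localFunctions := by
  refine comp_mem_localFunctions (E.overwrite r m) (fun s => ?_) hg
  -- At an additional setting the outcome does not depend on `l`, so any original setting will do
  -- there.
  have hu : ∀ i, ∃ u : S.Setting i, s (E.party i) ∈ Set.range (E.setting i) →
      E.setting i u = s (E.party i) := fun i => by
    by_cases h : s (E.party i) ∈ Set.range (E.setting i)
    · exact ⟨h.choose, fun _ => h.choose_spec⟩
    · exact ⟨s₀ i, fun h' => absurd h' h⟩
  choose u hu using hu
  refine ⟨u, fun l l' h i => ?_⟩
  by_cases hi : i ∈ Set.range E.party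
  · obtain ⟨i, rfl⟩ := hi
    by_cases hj : s (E.party i) ∈ Set.range (E.setting i)
    · rw [← hu i hj, overwrite_old, overwrite_old, h i]
    · rw [overwrite_newSetting _ _ _ _ _ hj, overwrite_newSetting _ _ _ _ _ hj]
  · rw [overwrite_newParty _ _ _ _ hi, overwrite_newParty _ _ _ _ hi]

/-! ### Lifting facet functions -/

/-- A function on the matching assignments that does not change with a single outcome is constant.
-/
theorem eq_of_forall_update {α : Type*} (E : Extension S T) (a : E.Choice) (t : T.Assignment → α)
    (h : ∀ m m' : T.Assignment, E.Matches a m → E.Matches a m' → ∀ i j,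
      (∀ i', i' ≠ i → m i' = m' i') → (∀ j', j' ≠ j → m i j' = m' i j') → t m = t m')
    {m m' : T.Assignment} (hm : E.Matches a m) (hm' : E.Matches a m') : t m = t m' := by
  -- `s` contains the settings where `m` may still differ from `m'`. Copying one outcome from `m'`
  -- keeps the assignment matching, because both match.
  have key : ∀ s : Finset ((i : T.Party) × T.Setting i), ∀ m : T.Assignment, E.Matches a m →
      (∀ i j, ⟨i, j⟩ ∉ s → m i j = m' i j) → t m = t m' := by
    intro s
    induction s using Finset.induction_on with
    | empty =>
      intro m _ h0
      rw [show m = m' from funext fun i => funext fun j => h0 i j (by simp)]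
    | insert x s _ ih =>
      intro m hm hs
      obtain ⟨i, j⟩ := x
      have hu : ∃ u : T.Assignment, (∀ i' j', (⟨i', j'⟩ : (i : T.Party) × T.Setting i) = ⟨i, j⟩ →
          u i' j' = m' i' j') ∧ ∀ i' j', (⟨i', j'⟩ : (i : T.Party) × T.Setting i) ≠ ⟨i, j⟩ →
          u i' j' = m i' j' :=
        ⟨fun i' j' => if (⟨i', j'⟩ : (i : T.Party) × T.Setting i) = ⟨i, j⟩ then m' i' j' else m i' j',
          fun _ _ e => if_pos e, fun _ _ e => if_neg e⟩
      obtain ⟨u, hu1, hu2⟩ := hu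
      have huM : E.Matches a u := fun i' h' => by
        by_cases e : (⟨i', (a i' h').1⟩ : (i : T.Party) × T.Setting i) = ⟨i, j⟩
        · rw [hu1 _ _ e, hm' i' h']
        · rw [hu2 _ _ e, hm i' h']
      rw [← ih u huM fun i' j' hn => ?_]
      · refine h m u hm huM i j (fun i' e => funext fun j' => ?_) fun j' e => ?_
        · exact (hu2 _ _ fun h' => e (congrArg Sigma.fst h')).symm
        · exact (hu2 _ _ fun h' => e (by simpa using h')).symm
      · by_cases e : (⟨i', j'⟩ : (i : T.Party) × T.Setting i) = ⟨i, j⟩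
        · exact hu1 _ _ e
        · rw [hu2 _ _ e, hs i' j' (by simp [e, hn])]
  exact key Finset.univ m hm fun i j h => absurd (Finset.mem_univ _) h

/-- The lifting of a facet function is a facet function if no two outcomes are merged to the only
outcome that the function sees, and the function sees all parties with additional settings. -/
theorem isFacetFunction_liftFunction (E : Extension S T) (r : E.Merging) (a : E.Choice)
    [Nonempty T.Assignment]
    (s₀ : (i : S.Party) → S.Setting i) {f : S.Assignment → ℝ} (hf : f ∈ S.localFunctions)
    (h : S.IsFacetFunction f)
    (hmerge : ∀ i j x x', x ≠ x' → r.merge i j x = r.merge i j x' →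
      ¬ S.IsSupportedAt f i j (r.merge i j x))
    (hsetting : ∀ i (j : T.Setting (E.party i)), j ∉ Set.range (E.setting i) →
      ∃ l l' : S.Assignment, (∀ i', i' ≠ i → l i' = l' i') ∧ f l ≠ f l')
    (hparty : ∀ i hi, ∃ y, y ≠ (a i hi).2) :
    T.IsFacetFunction (E.liftFunction r a f) := by
  obtain ⟨m₀, hm₀⟩ : ∃ m : T.Assignment, E.Matches a m := by
    obtain ⟨m⟩ := ‹Nonempty T.Assignment›
    refine ⟨fun i => if hi : i ∉ Set.range E.party then
      Function.update (m i) (a i hi).1 (a i hi).2 else m i, fun i hi => ?_⟩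
    simp only [dif_pos hi, Function.update_self]
  obtain ⟨l₀, hl₀⟩ := h.exists_eq_zero
  obtain ⟨l₁, hl₁⟩ := h.exists_ne_zero
  refine ⟨fun m => ?_, ⟨E.overwrite r m₀ l₀, ?_⟩, ⟨E.overwrite r m₀ l₁, ?_⟩, fun g hg hz => ?_⟩
  · rw [liftFunction]
    split_ifs
    · exact h.nonneg _
    · exact le_rfl
  · rw [E.liftFunction_overwrite r a f hm₀, hl₀]
  · rw [E.liftFunction_overwrite r a f hm₀]
    exact hl₁
  have hg0 : ∀ m, ¬ E.Matches a m → g m = 0 := fun m hm => hz m (if_neg hm)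
  have ht : ∀ m, ∃ t : ℝ, E.Matches a m → ∀ l, g (E.overwrite r m l) = t * f l := fun m => by
    by_cases hm : E.Matches a m
    · obtain ⟨t, ht⟩ := h.eq_mul _ (E.comp_overwrite_mem_localFunctions r m s₀ hg) fun l hl =>
        hz _ (by rw [E.liftFunction_overwrite r a f hm, hl])
      exact ⟨t, fun _ => ht⟩
    · exact ⟨0, fun h' => absurd h' hm⟩
  choose t ht using ht
  have hconst : ∀ m m', E.Matches a m → E.Matches a m' → t m = t m' := by
    intro m m' hm hm'
    refine E.eq_of_forall_update a t ?_ hm hm'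
    intro m m' hm hm' i j hi hj
    by_contra hne
    have hdiff : ∀ l, g (E.overwrite r m l) - g (E.overwrite r m' l) = (t m - t m') * f l :=
      fun l => by rw [ht m hm, ht m' hm']; ring
    have hcancel : ∀ l l', g (E.overwrite r m l) - g (E.overwrite r m' l) =
        g (E.overwrite r m l') - g (E.overwrite r m' l') → f l = f l' := fun l l' e => by
      rw [hdiff, hdiff] at e
      exact mul_left_cancel₀ (sub_ne_zero.2 hne) e
    by_cases hiE : i ∈ Set.range E.party
    · obtain ⟨i, rfl⟩ := hiE
      have hoff : ∀ l l' : S.Assignment, (∀ i', i' ≠ i → l i' = l' i') → ∀ i', i' ≠ E.party i →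
          E.overwrite r m l i' = E.overwrite r m' l i' ∧
          E.overwrite r m l i' = E.overwrite r m l' i' ∧
          E.overwrite r m l i' = E.overwrite r m' l' i' := fun l l' hl i' hi' => by
        have hl' : ∀ i'', E.party i'' = i' → l i'' = l' i'' := fun i'' e =>
          hl i'' fun e' => hi' (by rw [← e, e'])
        exact ⟨E.overwrite_congr r (hi i' hi') fun _ _ => rfl, E.overwrite_congr r rfl hl',
          E.overwrite_congr r (hi i' hi') hl'⟩
      by_cases hjE : j ∈ Set.range (E.setting i)
      · obtain ⟨j, rfl⟩ := hjE
        -- Let `l` and `l'` differ only for party `i` and agree at `j`. Passing from `m` to `m'`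
        -- affects only setting `j`, passing from `l` to `l'` only the others, so the rectangle
        -- identity applies.
        have hsupp := h.isSupportedAt hf i j (fun l l' hl hlj => hcancel l l' (by
          refine T.rectangle_of_mem_localFunctions hg (hoff l l' hl) fun j' => ?_
          by_cases hj' : j' ∈ Set.range (E.setting i)
          · obtain ⟨j', rfl⟩ := hj'
            by_cases e : j' = j
            · subst e
              right
              simp only [overwrite_old, hlj, and_self]
            · left
              simp only [overwrite_old, hj _ fun e' => e ((E.setting i).injective e'), and_self]
          · left
            simp only [overwrite_newSetting _ _ _ _ _ hj']
            exact ⟨hj _ fun e => hj' ⟨j, e.symm⟩, hj _ fun e => hj' ⟨j, e.symm⟩⟩)) hl₁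
        -- Equal outcomes at `j` would make the two overwritten assignments equal, contradicting `t
        -- m ≠ t m'` at `l₁`. So two distinct outcomes merge to `l₁ i j`.
        have hne' : E.overwrite r m l₁ (E.party i) (E.setting i j) ≠
            E.overwrite r m' l₁ (E.party i) (E.setting i j) := fun e => by
          have heq : E.overwrite r m l₁ = E.overwrite r m' l₁ := by
            funext i'
            by_cases hi' : i' = E.party i
            · subst hi'
              funext j'
              by_cases hj' : j' ∈ Set.range (E.setting i)
              · obtain ⟨j', rfl⟩ := hj'
                by_cases e' : j' = j
                · subst e'; exact e
                · simp only [overwrite_old, hj _ fun e'' => e' ((E.setting i).injective e'')]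
              · simp only [overwrite_newSetting _ _ _ _ _ hj']
                exact hj _ fun e => hj' ⟨j, e.symm⟩
            · exact (hoff l₁ l₁ (fun _ _ => rfl) i' hi').1
          have := hdiff l₁
          rw [heq, sub_self] at this
          exact mul_ne_zero (sub_ne_zero.2 hne) hl₁ this.symm
        refine hmerge i j _ _ hne' ?_ ?_
        · rw [merge_overwrite, merge_overwrite]
        · rw [merge_overwrite]
          exact hsupp
      · obtain ⟨l, l', hl, hfl⟩ := hsetting i j hjE
        refine hfl (hcancel l l' (T.rectangle_of_mem_localFunctions hg (hoff l l' hl) fun j' => ?_))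
        by_cases e : j' = j
        · subst e
          right
          simp only [overwrite_newSetting _ _ _ _ _ hjE, and_self]
        · left
          by_cases hj' : j' ∈ Set.range (E.setting i)
          · obtain ⟨j', rfl⟩ := hj'
            simp only [overwrite_old, hj _ e, and_self]
          · simp only [overwrite_newSetting _ _ _ _ _ hj', hj _ e, and_self]
    · by_cases e : j = (a i hiE).1
      · have heq : m = m' := by
          funext i'
          by_cases e' : i' = i
          · subst e'
            funext j'
            by_cases e'' : j' = j
            · rw [e'', e, hm i' hiE, hm' i' hiE]
            · exact hj _ e''
          · exact hi _ e'
        exact hne (by rw [heq])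
      -- For another setting of an additional party, switch its chosen outcome to `y`. Matching then
      -- fails and `g` vanishes, so the rectangle identity shows that the change of outcome at `j`
      -- has no effect on `g`.
      · obtain ⟨y, hy⟩ := hparty i hiE
        set M := E.overwrite r m l₁ with hM
        set M' := E.overwrite r m' l₁ with hM'
        have hMi : M i = m i := E.overwrite_newParty r m l₁ hiE
        have hMi' : M' i = m' i := E.overwrite_newParty r m' l₁ hiE
        have hoff : ∀ i', i' ≠ i → M i' = M' i' := fun i' e' =>
          E.overwrite_congr r (hi i' e') fun _ _ => rfl
        let N : T.Assignment → T.Assignment := fun M =>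
          Function.update M i (Function.update (M i) (a i hiE).1 y)
        have hN : ∀ M, g (N M) = 0 := fun M => hg0 _ fun hmat => by
          have := hmat i hiE
          simp only [N, Function.update_self] at this
          exact hy this
        have hrect := T.rectangle_of_mem_localFunctions hg (i := i) (a := M) (b := M')
          (c := N M) (d := N M') (fun i' e' => by simp [N, e', hoff i' e']) (fun j' => by
            by_cases e' : j' = (a i hiE).1
            · left
              subst e'
              simp [N, hMi, hMi', hm i hiE, hm' i hiE]
            · right
              simp [N, e'])
        rw [hN, hN, sub_self, hdiff] at hrect
        exact mul_ne_zero (sub_ne_zero.2 hne) hl₁ hrect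
  refine ⟨t m₀, fun m => ?_⟩
  by_cases hm : E.Matches a m
  · rw [liftFunction, if_pos hm, hconst m₀ m hm₀ hm, ← ht m hm, overwrite_restrict]
  · rw [hg0 m hm, liftFunction, if_neg hm, mul_zero]

/-! ### From lifted functions back to inequalities -/

/-- The value of the lifted coefficients on a deterministic vector. -/
theorem lift_dotProduct_det (E : Extension S T) (r : E.Merging) (a : E.Choice) (c : S.Index → ℝ)
    (m : T.Assignment) :
    E.lift r a c ⬝ᵥ T.det m = E.liftFunction r a (fun l => c ⬝ᵥ S.det l) m := by
  have key : ∀ x : S.Index, (∑ y : T.Index, if E.LiesOver r a x y then T.det m y else 0) =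
      if E.Matches a m then S.det (E.restrict r m) x else 0 := by
    intro x
    -- The only component that can contribute: its settings are dictated by `x` and `a`, its
    -- outcomes by `m`.
    let y₀ : T.Index := extendPi E.party
      (fun i => ⟨E.setting i (x i).1, m (E.party i) (E.setting i (x i).1)⟩)
      (fun i hi => ⟨(a i hi).1, m i (a i hi).1⟩)
    have hy₀ : ∀ i, y₀ (E.party i) =
        ⟨E.setting i (x i).1, m (E.party i) (E.setting i (x i).1)⟩ := fun i => by simp [y₀]
    have hy₀' : ∀ i hi, y₀ i = ⟨(a i hi).1, m i (a i hi).1⟩ := fun i hi => by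
      simp [y₀, extendPi_of_notMem _ _ _ hi]
    have hdet : T.det m y₀ = 1 := if_pos fun i => by
      by_cases hi : i ∈ Set.range E.party
      · obtain ⟨i, rfl⟩ := hi
        rw [hy₀]
      · rw [hy₀' i hi]
    rw [Finset.sum_eq_single y₀ _ (by simp), hdet]
    · have hiff : E.LiesOver r a x y₀ ↔ E.Matches a m ∧
          ∀ i, E.restrict r m i (x i).1 = (x i).2 := by
        constructor
        · rintro ⟨h1, h2⟩
          refine ⟨fun i hi => ?_, fun i => ?_⟩
          · have := h2 i hi
            rw [hy₀' i hi] at this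
            rw [Sigma.ext_iff] at this
            exact eq_of_heq this.2
          · obtain ⟨k, hk, hk'⟩ := h1 i
            rw [hy₀ i] at hk
            rw [Sigma.ext_iff] at hk
            have e : m (E.party i) (E.setting i (x i).1) = k := eq_of_heq hk.2
            rw [← hk', ← e]
            rfl
        · rintro ⟨h1, h2⟩
          refine ⟨fun i => ⟨_, hy₀ i, h2 i⟩, fun i hi => ?_⟩
          rw [hy₀' i hi, h1 i hi]
      by_cases h1 : E.Matches a m <;> simp [hiff, h1, det]
    · intro y _ hne
      rw [ite_eq_right_iff]
      rintro ⟨h1, h2⟩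
      refine if_neg fun hm => hne (funext fun i => ?_)
      have hyi : y i = ⟨(y i).1, m i (y i).1⟩ := by rw [hm i]
      by_cases hi : i ∈ Set.range E.party
      · obtain ⟨i, rfl⟩ := hi
        obtain ⟨k, hk, -⟩ := h1 i
        rw [hyi, hy₀, hk]
      · rw [hyi, hy₀' i hi, h2 i hi]
  rw [dotProduct]
  simp only [lift, Finset.sum_mul, ite_mul, zero_mul]
  rw [Finset.sum_comm]
  have : ∀ x, (∑ y, if E.LiesOver r a x y then c x * T.det m y else 0) =
      c x * if E.Matches a m then S.det (E.restrict r m) x else 0 := fun x => by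
    rw [← key x, Finset.mul_sum]
    simp only [mul_ite, mul_zero]
  simp only [this, liftFunction]
  split_ifs <;> simp [dotProduct]

end Extension

theorem sub_const_mem_localFunctions (S : Scenario) (s : (i : S.Party) → S.Setting i)
    (b : S.Index → ℝ) (b₀ : ℝ) : (fun l => b ⬝ᵥ S.det l - b₀) ∈ S.localFunctions :=
  Submodule.sub_mem _ (S.dotProduct_det_mem_localFunctions b) (S.const_mem_localFunctions s b₀)

/-- A facet function sees every party that has a setting with at least two outcomes. -/
theorem IsFacetFunction.exists_ne_of_nontrivial {S : Scenario} {f : S.Assignment → ℝ}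
    (h : S.IsFacetFunction f) (hf : f ∈ S.localFunctions) (i : S.Party) (j : S.Setting i)
    [Nontrivial (S.Outcome i j)] :
    ∃ l l' : S.Assignment, (∀ i', i' ≠ i → l i' = l' i') ∧ f l ≠ f l' := by
  by_contra! hall
  obtain ⟨l, hl⟩ := h.exists_ne_zero
  have hs := h.isSupportedAt hf i j (fun l l' e _ => hall l l' e) hl
  obtain ⟨k, hk⟩ := exists_ne (l i j)
  refine hl ?_
  rw [hall l (Function.update l i (Function.update (l i) j k)) (fun i' e => by simp [e])]
  exact hs.apply_eq_zero (by simpa using hk)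

/-- The scenario with one more setting, as an extension. -/
def addSettingExtension (S : Scenario) (i' : S.Party) (W : Type) [Fintype W] :
    Extension S (S.addSetting i' W) where
  party := Function.Embedding.refl _
  setting _ := ⟨Sum.inl, Sum.inl_injective⟩
  outcome i j := Function.Embedding.refl (S.Outcome i j)

/-- No outcomes have to be merged for one more setting. -/
def addSettingMerging (S : Scenario) (i' : S.Party) (W : Type) [Fintype W] :
    (S.addSettingExtension i' W).Merging where
  merge i j := (id : S.Outcome i j → S.Outcome i j)
  merge_outcome _ _ _ := rfl

theorem addSettingCoeff_dotProduct_det (S : Scenario) (i' : S.Party) (W : Type) [Fintype W]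
    (b : S.Index → ℝ) (m : (S.addSetting i' W).Assignment) :
    S.addSettingCoeff i' W b ⬝ᵥ (S.addSetting i' W).det m =
      b ⬝ᵥ S.det ((S.addSettingExtension i' W).restrict (S.addSettingMerging i' W) m) := by
  simp only [dotProduct, addSettingCoeff, Finset.sum_mul, ite_mul, zero_mul]
  rw [Finset.sum_comm]
  refine Finset.sum_congr rfl fun x _ => ?_
  rw [Finset.sum_ite_eq]
  simp only [Finset.mem_univ, if_true]
  rfl

theorem SupportsFacet.addSetting {S : Scenario} {b : S.Index → ℝ} {b₀ : ℝ}
    (h : S.SupportsFacet b b₀) (hg : S.Genuine b b₀) (i' : S.Party) (W : Type) [Fintype W]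
    [Nonempty W] : (S.addSetting i' W).SupportsFacet (S.addSettingCoeff i' W b) b₀ := by
  obtain ⟨s₀⟩ := h.nonempty_selection
  have hf := S.sub_const_mem_localFunctions s₀ b b₀
  have hfac := h.isFacetFunction
  have hsup := hg.not_isSupportedAt (Equivalent.refl S b b₀)
  have hparty : ∀ i, i ∈ Set.range (S.addSettingExtension i' W).party := fun i => ⟨i, rfl⟩
  obtain ⟨l₁, hl₁⟩ := hfac.exists_ne_zero
  have : Nonempty (S.addSetting i' W).Assignment :=
    ⟨fun i j => match j with
      | .inl j => l₁ i j
      | .inr _ => Classical.arbitrary W⟩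
  have key := (S.addSettingExtension i' W).isFacetFunction_liftFunction
    (S.addSettingMerging i' W) (fun i hi => absurd (hparty i) hi) s₀ hf hfac
    (fun i j x x' hne he => absurd he hne)
    -- A facet function blind to party `i` would be concentrated on one outcome of `s₀ i`, against
    -- genuineness. Settings with a single outcome are allowed here, so counting outcomes would not
    -- suffice.
    (fun i _ _ => by
      by_contra! hall
      exact hsup i (s₀ i) _ (hfac.isSupportedAt hf i (s₀ i) (fun l l' e _ => hall l l' e) hl₁))
    (fun i hi => absurd (hparty i) hi)
  refine IsFacetFunction.supportsFacet (S := S.addSetting i' W) (fun i => Sum.inl (s₀ i)) ?_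
  convert key using 1
  funext m
  rw [addSettingCoeff_dotProduct_det, Extension.liftFunction]
  exact (if_pos fun i hi => absurd (hparty i) hi).symm

theorem SupportsFacet.exists_equivalent {S : Scenario} {b : S.Index → ℝ} {b₀ : ℝ}
    (h : S.SupportsFacet b b₀) : ∃ c, S.Equivalent b b₀ c 0 := by
  obtain ⟨s₀⟩ := h.nonempty_selection
  obtain ⟨c, hc⟩ := S.exists_coeff_of_mem_localFunctions (S.sub_const_mem_localFunctions s₀ b b₀)
  refine ⟨c, 1, one_pos, fun p hp => ?_⟩
  have := S.eq_of_mem_polytope (c := c - b) (c₀ := -b₀)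
    (fun l => by rw [sub_dotProduct, ← hc l]; ring) hp
  rw [sub_dotProduct] at this
  linarith

theorem SupportsFacet.lift {S T : Scenario} (E : Extension S T)
    (hT : ∀ i, Nonempty (T.Setting i)) (hS2 : ∀ i j, 2 ≤ Fintype.card (S.Outcome i j))
    (hT2 : ∀ i j, 2 ≤ Fintype.card (T.Outcome i j)) {b c : S.Index → ℝ} {b₀ : ℝ}
    (h : S.SupportsFacet b b₀) (hc : S.Equivalent b b₀ c 0) (r : E.Merging)
    (hmerge : ∀ i j x x', x ≠ x' → r.merge i j x = r.merge i j x' →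
      ¬ S.IsSupportedAt (fun l => c ⬝ᵥ S.det l) i j (r.merge i j x)) (a : E.Choice) :
    T.SupportsFacet (E.lift r a c) 0 := by
  have hSnt : ∀ i j, Nontrivial (S.Outcome i j) := fun i j =>
    Fintype.one_lt_card_iff_nontrivial.1 (hS2 i j)
  have hTnt : ∀ i j, Nontrivial (T.Outcome i j) := fun i j =>
    Fintype.one_lt_card_iff_nontrivial.1 (hT2 i j)
  obtain ⟨s₀⟩ := h.nonempty_selection
  obtain ⟨μ, hμ, he⟩ := hc
  have hfac : S.IsFacetFunction fun l => c ⬝ᵥ S.det l := by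
    convert h.isFacetFunction.const_mul hμ using 1
    funext l
    rw [← he _ (S.det_mem_polytope l), sub_zero]
  have hf := S.dotProduct_det_mem_localFunctions c
  have key := E.isFacetFunction_liftFunction r a s₀ hf hfac hmerge
    (fun i _ _ => hfac.exists_ne_of_nontrivial hf i (s₀ i)) (fun i hi => exists_ne _)
  refine IsFacetFunction.supportsFacet (fun i => Classical.arbitrary _) ?_
  convert key using 1
  funext m
  rw [sub_zero, E.lift_dotProduct_det]

/-- Additional outcomes can be merged with any chosen outcome of every setting. -/
theorem Extension.exists_merging {S T : Scenario} (E : Extension S T)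
    (k₀ : (i : S.Party) → (j : S.Setting i) → S.Outcome i j) :
    ∃ r : E.Merging, ∀ i j x x', x ≠ x' → r.merge i j x = r.merge i j x' →
      r.merge i j x = k₀ i j := by
  refine ⟨⟨fun i j => Function.extend (E.outcome i j) id fun _ => k₀ i j, fun i j k =>
    (E.outcome i j).injective.extend_apply _ _ _⟩, fun i j x x' hne he => ?_⟩
  -- An outcome is either merged to `k₀ i j` or is an original one, recovered from its merging; two
  -- distinct originals never merge.
  have hext : ∀ x, Function.extend (E.outcome i j) id (fun _ => k₀ i j) x = k₀ i j ∨
      x = E.outcome i j (Function.extend (E.outcome i j) id (fun _ => k₀ i j) x) := fun x => by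
    by_cases hx : ∃ k, E.outcome i j k = x
    · obtain ⟨k, rfl⟩ := hx
      right
      rw [(E.outcome i j).injective.extend_apply, id]
    · exact Or.inl (Function.extend_apply' _ _ _ hx)
  dsimp only at he ⊢
  rcases hext x with h1 | h1
  · exact h1
  · rcases hext x' with h2 | h2
    · exact he.trans h2
    · exact absurd (by rw [h1, h2, he]) hne

/-- Merge into outcomes avoided by an assignment `l₁` off the facet: concentration on such an
outcome would put `l₁` on the facet. As `l₁` depends only on the inequality for `b`, one merging
serves all equivalent `c`. -/
theorem SupportsFacet.exists_merging {S T : Scenario} (E : Extension S T)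
    (hS2 : ∀ i j, 2 ≤ Fintype.card (S.Outcome i j)) {b : S.Index → ℝ} {b₀ : ℝ}
    (h : S.SupportsFacet b b₀) :
    ∃ r : E.Merging, ∀ c, S.Equivalent b b₀ c 0 → ∀ i j x x', x ≠ x' →
      r.merge i j x = r.merge i j x' →
      ¬ S.IsSupportedAt (fun l => c ⬝ᵥ S.det l) i j (r.merge i j x) := by
  obtain ⟨l₁, hl₁⟩ := h.isFacetFunction.exists_ne_zero
  have hk : ∀ i j, ∃ k : S.Outcome i j, k ≠ l₁ i j := fun i j => by
    have := Fintype.one_lt_card_iff_nontrivial.1 (hS2 i j)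
    exact exists_ne _
  choose k₀ hk₀ using hk
  obtain ⟨r, hr⟩ := E.exists_merging k₀
  refine ⟨r, fun c hc i j x x' hne he hs => ?_⟩
  rw [hr i j x x' hne he] at hs
  have h0 := hs.apply_eq_zero (hk₀ i j).symm
  obtain ⟨μ, hμ, heq⟩ := hc
  have := heq _ (S.det_mem_polytope l₁)
  rw [h0, sub_zero] at this
  exact mul_ne_zero hμ.ne' hl₁ this.symm

end Scenario

end

theorem theorem5 :
    -- one more measurement setting
    (∀ (S : Scenario) (i' : S.Party) (W : Type) [Fintype W] [Nonempty W]
        (b : S.Index → ℝ) (b₀ : ℝ),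
        S.SupportsFacet b b₀ → S.Genuine b b₀ →
          (S.addSetting i' W).SupportsFacet (S.addSettingCoeff i' W b) b₀) ∧
    -- more parties, settings and outcomes
    (∀ (S T : Scenario) (E : Scenario.Extension S T),
        (∀ i, Nonempty (T.Setting i)) →
        (∀ i j, 2 ≤ Fintype.card (S.Outcome i j)) →
        (∀ i j, 2 ≤ Fintype.card (T.Outcome i j)) →
        ∀ (b : S.Index → ℝ) (b₀ : ℝ), S.SupportsFacet b b₀ →
          (∃ c, S.Equivalent b b₀ c 0) ∧
          (S.Genuine b b₀ → ∀ c, S.Equivalent b b₀ c 0 →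
            ∀ (r : E.Merging) (a : E.Choice), T.SupportsFacet (E.lift r a c) 0) ∧
          (∃ r : E.Merging, ∀ c, S.Equivalent b b₀ c 0 →
            ∀ a : E.Choice, T.SupportsFacet (E.lift r a c) 0)) := by
  refine ⟨fun S i' W _ _ b b₀ h hg => h.addSetting hg i' W,
    fun S T E hT hS2 hT2 b b₀ h => ⟨h.exists_equivalent, fun hg c hc r a => ?_, ?_⟩⟩
  · refine h.lift E hT hS2 hT2 hc r (fun i j x _ _ _ => ?_) a
    simpa using hg.not_isSupportedAt hc i j (r.merge i j x)
  · obtain ⟨r, hr⟩ := h.exists_merging E hS2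
    exact ⟨r, fun c hc a => h.lift E hT hS2 hT2 hc r (hr c hc) a⟩
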